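/- Let $\mathcal A$ be a skeletally small semi-abelian category, i.e. an additive category with kernels and cokernels in which every morphism factors both as a cokernel followed by a monomorphism and as an epimorphism followed by a kernel. A sequence $\xi\colon X\xrightarrow{f}Y\xrightarrow{g}Z$ is short exact if $f$ is a kernel of $g$ and $g$ is a cokernel of $f$. For $a\colon X\to X'$, pushing out $f$ along $a$ gives a complex $a\xi\colon X'\to X'\amalg_XY\to Z$; for $b\colon Z'\to Z$, pulling back $g$ along $b$ gives a complex $\xi b\colon X\to Y\times_ZZ'\to Z'$. A short exact sequence $\xi$ is stable exact if $a\xi$ and $\xi b$ are short exact for all such $a,b$. Let $\operatorname{Ext}^1_{\mathcal A}(Z,X)$ be the set of equivalence classes of stable exact sequences $X\to Y\to Z$ under isomorphisms that are the identity on $X$ and on $Z$; it is an abelian group under the Baer sum $\xi+\xi'=\nabla_X(\xi\oplus\xi')\Delta_Z$, with zero element the class of the split sequence $X\to X\oplus Z\to Z$. The assignments $a\mapsto(\xi\mapsto a\xi)$ and $b\mapsto(\xi\mapsto\xi b)$ make $\operatorname{Ext}^1_{\mathcal A}(Z,-)\colon\mathcal A\to\mathsf{Ab}$ a covariant, and $\operatorname{Ext}^1_{\mathcal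 A}(-,X)\colon\mathcal A^{\mathrm{op}}\to\mathsf{Ab}$ a contravariant, additive functor. For an additive functor $F\colon\mathcal B\to\mathsf{Ab}$ on an additive category $\mathcal B$, an element $x\in F(B)$ is minimal if $x\neq0$ and $F(p)(x)=0$ for every epimorphism $p\colon B\to B'$ in $\mathcal B$ that is not an isomorphism; for a contravariant functor on $\mathcal A$ this is applied with $\mathcal B=\mathcal A^{\mathrm{op}}$. A morphism $f$ is irreducible if it is neither a section nor a retraction and, whenever $f=hg$, either $h$ is a retraction or $g$ is a section. An object is indecomposable if it is non-zero and is not isomorphic to a direct sum of two non-zero objects. Let $X,Z$ be objects of $\mathcal A$ and let $\xi\colon X\xrightarrow{f}Y\xrightarrow{g}Z$ be a stable exact sequence, regarded as an element of $\operatorname{Ext}^1_{\mathcal A}(Z,X)$. (i) If $f$ is irreducible, then $\xi\in\operatorname{Ext}^1_{\mathcal A}(-,X)(Z)$ is minimal, and hence $Z$ is indecomposable. (ii) If $g$ is irreducible, then $\xi\in\operatorname{Ext}^1_{\mathcal A}(Z,-)(X)$ is minimal, and hence $X$ is indecomposable. -/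

import Mathlib

open CategoryTheory CategoryTheory.Limits

universe w v u

namespace SemiAb

section Basic

variable {C : Type u} [Category.{v} C]

/-- A morphism is irreducible if it is neither a section nor a retraction and, in every
factorisation `f = g ≫ h`, either `g` is a section or `h` is a retraction. -/
structure IsIrreducible {X Y : C} (f : X ⟶ Y) : Prop where
  not_section : ¬ IsSplitMono f
  not_retraction : ¬ IsSplitEpi f
  factor : ∀ {W : C} (g : X ⟶ W) (h : W ⟶ Y), f = g ≫ h → IsSplitEpi h ∨ IsSplitMono g

/-- `x ∈ F(X)` is minimal if `x ≠ 0` and `F(p)(x) = 0` for every proper epimorphism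
`p : X ⟶ Y`, i.e. every epimorphism that is not an isomorphism. -/
structure IsMinimal [Preadditive C] (F : C ⥤ Ab.{w}) [F.Additive] {X : C}
    (x : F.obj X) : Prop where
  ne_zero : x ≠ 0
  map_eq_zero : ∀ {Y : C} (p : X ⟶ Y), Epi p → ¬ IsIso p → F.map p x = 0

variable [Preadditive C]

/-- `f` is a kernel of `g`. -/
def IsKer {X Y Z : C} (f : X ⟶ Y) (g : Y ⟶ Z) : Prop :=
  ∃ w : f ≫ g = 0, Nonempty (IsLimit (KernelFork.ofι f w))

/-- `g` is a cokernel of `f`. -/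
def IsCoker {X Y Z : C} (f : X ⟶ Y) (g : Y ⟶ Z) : Prop :=
  ∃ w : f ≫ g = 0, Nonempty (IsColimit (CokernelCofork.ofπ g w))

/-- `f` is the kernel of some morphism. -/
def IsSomeKer {X Y : C} (f : X ⟶ Y) : Prop := ∃ (Z : C) (g : Y ⟶ Z), IsKer f g

/-- `g` is the cokernel of some morphism. -/
def IsSomeCoker {Y Z : C} (g : Y ⟶ Z) : Prop := ∃ (X : C) (f : X ⟶ Y), IsCoker f g

variable (C) in
/-- A preabelian category is an additive category in which every morphism has a kernel and a
cokernel. -/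
class Preabelian : Prop where
  hasFiniteBiproducts : HasFiniteBiproducts C
  hasKernels : HasKernels C
  hasCokernels : HasCokernels C

attribute [instance] Preabelian.hasFiniteBiproducts Preabelian.hasKernels
  Preabelian.hasCokernels

instance [Preabelian C] : HasBinaryBiproducts C := hasBinaryBiproducts_of_finite_biproducts C

variable (C) in
/-- A preabelian category is left semi-abelian if every morphism is a cokernel followed by a
monomorphism, right semi-abelian if every morphism is an epimorphism followed by a kernel, and
semi-abelian if it is both. -/
class SemiAbelian : Prop extends Preabelian C where
  left : ∀ {A B : C} (f : A ⟶ B), ∃ (I : C) (p : A ⟶ I) (i : I ⟶ B),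
    f = p ≫ i ∧ IsSomeCoker p ∧ Mono i
  right : ∀ {A B : C} (f : A ⟶ B), ∃ (I : C) (p : A ⟶ I) (i : I ⟶ B),
    f = p ≫ i ∧ Epi p ∧ IsSomeKer i

theorem isKer_iff {X Y Z : C} {f : X ⟶ Y} {g : Y ⟶ Z} :
    IsKer f g ↔ f ≫ g = 0 ∧ Mono f ∧ ∀ {T : C} (t : T ⟶ Y), t ≫ g = 0 → ∃ u, u ≫ f = t := by
  constructor
  · rintro ⟨w, ⟨h⟩⟩
    refine ⟨w, ⟨fun a b hab => Fork.IsLimit.hom_ext h hab⟩, fun t ht => ?_⟩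
    exact ⟨_, (KernelFork.IsLimit.lift' h t ht).2⟩
  · rintro ⟨w, hm, h⟩
    exact ⟨w, ⟨KernelFork.IsLimit.ofι' f w fun t ht => ⟨(h t ht).choose, (h t ht).choose_spec⟩⟩⟩

theorem isCoker_iff {X Y Z : C} {f : X ⟶ Y} {g : Y ⟶ Z} :
    IsCoker f g ↔ f ≫ g = 0 ∧ Epi g ∧ ∀ {T : C} (t : Y ⟶ T), f ≫ t = 0 → ∃ u, g ≫ u = t := by
  constructor
  · rintro ⟨w, ⟨h⟩⟩
    refine ⟨w, ⟨fun a b hab => Cofork.IsColimit.hom_ext h hab⟩, fun t ht => ?_⟩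
    exact ⟨_, (CokernelCofork.IsColimit.desc' h t ht).2⟩
  · rintro ⟨w, hm, h⟩
    exact ⟨w, ⟨CokernelCofork.IsColimit.ofπ' g w
      fun t ht => ⟨(h t ht).choose, (h t ht).choose_spec⟩⟩⟩

theorem IsSomeKer.isKer {X Y Z : C} {f : X ⟶ Y} (hf : IsSomeKer f) {g : Y ⟶ Z}
    (hg : IsCoker f g) : IsKer f g := by
  obtain ⟨W, k, hk⟩ := hf
  rw [isKer_iff] at hk ⊢
  rw [isCoker_iff] at hg
  obtain ⟨u, rfl⟩ := hg.2.2 k hk.1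
  exact ⟨hg.1, hk.2.1, fun t ht => hk.2.2 t (by rw [← Category.assoc, ht, zero_comp])⟩

theorem IsSomeCoker.isCoker {X Y Z : C} {f : X ⟶ Y} {g : Y ⟶ Z} (hg : IsSomeCoker g)
    (hf : IsKer f g) : IsCoker f g := by
  obtain ⟨W, k, hk⟩ := hg
  rw [isCoker_iff] at hk ⊢
  rw [isKer_iff] at hf
  obtain ⟨u, rfl⟩ := hf.2.2 k hk.1
  exact ⟨hf.1, hk.2.1, fun t ht => hk.2.2 t (by rw [Category.assoc, ht, comp_zero])⟩

/-- A kernel all of whose pushouts are kernels. -/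
def SemiStableKer {X Y : C} (f : X ⟶ Y) : Prop :=
  ∀ ⦃X' P : C⦄ (a : X ⟶ X') (i : X' ⟶ P) (v : Y ⟶ P), IsPushout a f i v → IsSomeKer i

/-- A cokernel all of whose pullbacks are cokernels. -/
def SemiStableCoker {Y Z : C} (g : Y ⟶ Z) : Prop :=
  ∀ ⦃Z' P : C⦄ (b : Z' ⟶ Z) (v : P ⟶ Y) (p : P ⟶ Z'), IsPullback v p g b → IsSomeCoker p

theorem isCoker_of_isPushout {X Y Z X' P : C} {f : X ⟶ Y} {g : Y ⟶ Z} {a : X ⟶ X'}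
    {i : X' ⟶ P} {v : Y ⟶ P} (h : IsPushout a f i v) (hg : IsCoker f g) {p : P ⟶ Z}
    (hi : i ≫ p = 0) (hv : v ≫ p = g) : IsCoker i p := by
  rw [isCoker_iff] at hg ⊢
  subst hv
  have := hg.2.1
  refine ⟨hi, epi_of_epi v p, fun t ht => ?_⟩
  obtain ⟨u, hu⟩ := hg.2.2 (v ≫ t) (by rw [← Category.assoc, ← h.w, Category.assoc, ht, comp_zero])
  exact ⟨u, h.hom_ext (by rw [← Category.assoc, hi, zero_comp, ht])
    (by rw [← Category.assoc, hu])⟩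

theorem isKer_of_isPullback {X Y Z Z' P : C} {f : X ⟶ Y} {g : Y ⟶ Z} {b : Z' ⟶ Z}
    {v : P ⟶ Y} {p : P ⟶ Z'} (h : IsPullback v p g b) (hf : IsKer f g) {i : X ⟶ P}
    (hi : i ≫ p = 0) (hv : i ≫ v = f) : IsKer i p := by
  rw [isKer_iff] at hf ⊢
  subst hv
  have := hf.2.1
  refine ⟨hi, mono_of_mono i v, fun t ht => ?_⟩
  obtain ⟨u, hu⟩ := hf.2.2 (t ≫ v) (by rw [Category.assoc, h.w, ← Category.assoc, ht, zero_comp])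
  exact ⟨u, h.hom_ext (by rw [Category.assoc, hu]) (by rw [Category.assoc, hi, comp_zero, ht])⟩

theorem SemiStableKer.isSomeKer {X Y : C} {f : X ⟶ Y} (hf : SemiStableKer f) : IsSomeKer f :=
  hf (𝟙 X) f (𝟙 Y) (IsPushout.of_horiz_isIso ⟨by simp⟩)

theorem SemiStableCoker.isSomeCoker {Y Z : C} {g : Y ⟶ Z} (hg : SemiStableCoker g) :
    IsSomeCoker g :=
  hg (𝟙 Z) (𝟙 Y) g (IsPullback.of_horiz_isIso ⟨by simp⟩)

theorem SemiStableKer.of_isPushout {X Y X' P : C} {f : X ⟶ Y} (hf : SemiStableKer f)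
    {a : X ⟶ X'} {i : X' ⟶ P} {v : Y ⟶ P} (h : IsPushout a f i v) : SemiStableKer i :=
  fun _ _ _ _ _ h' => hf _ _ _ (h.paste_horiz h')

theorem SemiStableCoker.of_isPullback {Y Z Z' P : C} {g : Y ⟶ Z} (hg : SemiStableCoker g)
    {b : Z' ⟶ Z} {v : P ⟶ Y} {p : P ⟶ Z'} (h : IsPullback v p g b) : SemiStableCoker p :=
  fun _ _ _ _ _ h' => hg _ _ _ (h'.paste_horiz h)

end Basic
end SemiAb

namespace SemiAb

section Stability

variable {C : Type u} [Category.{v} C] [Preadditive C]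

instance [HasBinaryBiproducts C] [HasCokernels C] : HasPushouts C :=
  have := Preadditive.hasCoequalizers_of_hasCokernels (C := C)
  hasPushouts_of_hasBinaryCoproducts_of_hasCoequalizers C

instance [HasBinaryBiproducts C] [HasKernels C] : HasPullbacks C :=
  have := Preadditive.hasEqualizers_of_hasKernels (C := C)
  hasPullbacks_of_hasBinaryProducts_of_hasEqualizers C

theorem exists_isCoker [HasCokernels C] {X Y : C} (f : X ⟶ Y) :
    ∃ (Z : C) (g : Y ⟶ Z), IsCoker f g :=
  ⟨_, cokernel.π f, cokernel.condition f, ⟨cokernelIsCokernel f⟩⟩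

theorem exists_isKer [HasKernels C] {Y Z : C} (g : Y ⟶ Z) :
    ∃ (X : C) (f : X ⟶ Y), IsKer f g :=
  ⟨_, kernel.ι g, kernel.condition g, ⟨kernelIsKernel g⟩⟩

theorem SemiStableKer.of_comp [HasPushouts C] [HasCokernels C]
    {X Y' Y : C} {f' : X ⟶ Y'} {b' : Y' ⟶ Y}
    (hf : SemiStableKer (f' ≫ b')) : SemiStableKer f' := by
  intro X' P a f₂ a'' h
  obtain ⟨Z, g, hg⟩ := exists_isCoker (f' ≫ b')
  obtain ⟨Z', g', hg'⟩ := exists_isCoker f'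
  have hg'' := isCoker_iff.1 hg'
  have hgg := isCoker_iff.1 hg
  obtain ⟨b, hb⟩ := hg''.2.2 (b' ≫ g) (by rw [← Category.assoc, hgg.1])
  obtain ⟨p, hfp, hap⟩ : ∃ p : P ⟶ Z', f₂ ≫ p = 0 ∧ a'' ≫ p = g' :=
    ⟨h.desc 0 g' (by rw [comp_zero, hg''.1]), h.inl_desc _ _ _, h.inr_desc _ _ _⟩
  have hp := isCoker_of_isPushout h hg' hfp hap
  refine ⟨Z', p, ?_⟩
  have hpp := isCoker_iff.1 hp
  have h0 := IsPushout.of_hasPushout a (f' ≫ b')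
  set i₀ := pushout.inl a (f' ≫ b')
  set v₀ := pushout.inr a (f' ≫ b')
  obtain ⟨m, hm1, hm2⟩ : ∃ m : P ⟶ _, f₂ ≫ m = i₀ ∧ a'' ≫ m = b' ≫ v₀ :=
    ⟨h.desc i₀ (b' ≫ v₀) (by rw [h0.w, Category.assoc]), h.inl_desc _ _ _, h.inr_desc _ _ _⟩
  obtain ⟨g₀, hg01, hg02⟩ : ∃ g₀ : _ ⟶ Z, i₀ ≫ g₀ = 0 ∧ v₀ ≫ g₀ = g :=
    ⟨h0.desc 0 g (by rw [comp_zero, hgg.1]), h0.inl_desc _ _ _, h0.inr_desc _ _ _⟩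
  have hi₀ := isKer_iff.1 ((hf _ _ _ h0).isKer (isCoker_of_isPushout h0 hg hg01 hg02))
  have hmg : m ≫ g₀ = p ≫ b := by
    apply h.hom_ext
    · rw [← Category.assoc, ← Category.assoc, hm1, hfp, hg01, zero_comp]
    · rw [← Category.assoc, ← Category.assoc, hm2, hap, Category.assoc, hg02, hb]
  have h1 := IsPushout.of_hasPushout (a ≫ f₂) (f' ≫ b')
  set j := pushout.inl (a ≫ f₂) (f' ≫ b')
  set v₁ := pushout.inr (a ≫ f₂) (f' ≫ b')
  obtain ⟨W, k, hk⟩ := hf _ _ _ h1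
  have hj := (isKer_iff.1 hk).2.1
  obtain ⟨n, hn1, hn2⟩ : ∃ n, i₀ ≫ n = f₂ ≫ j ∧ v₀ ≫ n = v₁ :=
    ⟨h0.desc (f₂ ≫ j) v₁ (by rw [← Category.assoc, h1.w]), h0.inl_desc _ _ _, h0.inr_desc _ _ _⟩
  obtain ⟨s, hs⟩ := hpp.2.2 (j - m ≫ n) (by
    rw [Preadditive.comp_sub, ← Category.assoc, hm1, hn1, sub_self])
  have hmono : Mono f₂ := by
    have := hi₀.2.1
    rw [← hm1] at this
    exact mono_of_mono f₂ m
  refine isKer_iff.2 ⟨hfp, hmono, fun t ht => ?_⟩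
  obtain ⟨x, hx⟩ := hi₀.2.2 (t ≫ m) (by
    rw [Category.assoc, hmg, ← Category.assoc, ht, zero_comp])
  refine ⟨x, (sub_eq_zero.1 ?_).symm⟩
  rw [← cancel_mono j, zero_comp]
  have e1 : (t - x ≫ f₂) ≫ m = 0 := by
    rw [Preadditive.sub_comp, Category.assoc, hm1, hx, sub_self]
  have e2 : (t - x ≫ f₂) ≫ p = 0 := by
    rw [Preadditive.sub_comp, Category.assoc, hfp, ht, comp_zero, sub_self]
  rw [sub_eq_iff_eq_add.1 hs.symm, Preadditive.comp_add, ← Category.assoc, e2, ← Category.assoc, e1,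
    zero_comp, zero_comp, zero_add]

theorem SemiStableCoker.of_comp [HasPullbacks C] [HasKernels C]
    {Y Y' Z : C} {b' : Y ⟶ Y'} {g' : Y' ⟶ Z}
    (hg : SemiStableCoker (b' ≫ g')) : SemiStableCoker g' := by
  intro Z' P a a'' g₂ h
  obtain ⟨X, f, hf⟩ := exists_isKer (b' ≫ g')
  obtain ⟨X', f', hf'⟩ := exists_isKer g'
  have hf'' := isKer_iff.1 hf'
  have hff := isKer_iff.1 hf
  obtain ⟨b, hb⟩ := hf''.2.2 (f ≫ b') (by rw [Category.assoc, hff.1])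
  obtain ⟨p, hgp, hap⟩ : ∃ p : X' ⟶ P, p ≫ g₂ = 0 ∧ p ≫ a'' = f' :=
    ⟨h.lift f' 0 (by rw [zero_comp, hf''.1]), h.lift_snd _ _ _, h.lift_fst _ _ _⟩
  have hp := isKer_of_isPullback h hf' hgp hap
  refine ⟨X', p, ?_⟩
  have hpp := isKer_iff.1 hp
  have h0 := IsPullback.of_hasPullback (b' ≫ g') a
  set i₀ := pullback.snd (b' ≫ g') a
  set v₀ := pullback.fst (b' ≫ g') a
  obtain ⟨m, hm1, hm2⟩ : ∃ m : _ ⟶ P, m ≫ g₂ = i₀ ∧ m ≫ a'' = v₀ ≫ b' :=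
    ⟨h.lift (v₀ ≫ b') i₀ (by rw [← h0.w, Category.assoc]), h.lift_snd _ _ _, h.lift_fst _ _ _⟩
  obtain ⟨f₀, hf01, hf02⟩ : ∃ f₀ : X ⟶ _, f₀ ≫ i₀ = 0 ∧ f₀ ≫ v₀ = f :=
    ⟨h0.lift f 0 (by rw [zero_comp, hff.1]), h0.lift_snd _ _ _, h0.lift_fst _ _ _⟩
  have hi₀ := isCoker_iff.1 ((hg _ _ _ h0).isCoker (isKer_of_isPullback h0 hf hf01 hf02))
  have hmf : f₀ ≫ m = b ≫ p := by
    apply h.hom_ext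
    · rw [Category.assoc, Category.assoc, hm2, hap, ← Category.assoc, hf02, hb]
    · rw [Category.assoc, Category.assoc, hm1, hgp, hf01, comp_zero]
  have h1 := IsPullback.of_hasPullback (b' ≫ g') (g₂ ≫ a)
  set j := pullback.snd (b' ≫ g') (g₂ ≫ a)
  set v₁ := pullback.fst (b' ≫ g') (g₂ ≫ a)
  obtain ⟨W, k, hk⟩ := hg _ _ _ h1
  have hj := (isCoker_iff.1 hk).2.1
  obtain ⟨n, hn1, hn2⟩ : ∃ n, n ≫ i₀ = j ≫ g₂ ∧ n ≫ v₀ = v₁ :=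
    ⟨h0.lift v₁ (j ≫ g₂) (by rw [Category.assoc, h1.w]), h0.lift_snd _ _ _, h0.lift_fst _ _ _⟩
  obtain ⟨s, hs⟩ := hpp.2.2 (j - n ≫ m) (by
    rw [Preadditive.sub_comp, Category.assoc, hm1, hn1, sub_self])
  have hepi : Epi g₂ := by
    have := hi₀.2.1
    rw [← hm1] at this
    exact epi_of_epi m g₂
  refine isCoker_iff.2 ⟨hgp, hepi, fun t ht => ?_⟩
  obtain ⟨x, hx⟩ := hi₀.2.2 (m ≫ t) (by
    rw [← Category.assoc, hmf, Category.assoc, ht, comp_zero])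
  refine ⟨x, (sub_eq_zero.1 ?_).symm⟩
  rw [← cancel_epi j, comp_zero]
  have e1 : m ≫ (t - g₂ ≫ x) = 0 := by
    rw [Preadditive.comp_sub, ← Category.assoc, hm1, hx, sub_self]
  have e2 : p ≫ (t - g₂ ≫ x) = 0 := by
    rw [Preadditive.comp_sub, ← Category.assoc, hgp, ht, zero_comp, sub_self]
  rw [sub_eq_iff_eq_add.1 hs.symm, Preadditive.add_comp, Category.assoc, e2, Category.assoc, e1,
    comp_zero, comp_zero, zero_add]

theorem SemiStableKer.comp [HasPushouts C] [HasCokernels C] {X Y Z : C} {f : X ⟶ Y} {f' : Y ⟶ Z}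
    (hf : SemiStableKer f) (hf' : SemiStableKer f') : SemiStableKer (f ≫ f') := by
  intro X' P a i v h
  have h0 := IsPushout.of_hasPushout a f
  set i₀ := pushout.inl a f
  set v₀ := pushout.inr a f
  obtain ⟨j, hj1, hj2⟩ : ∃ j, i₀ ≫ j = i ∧ v₀ ≫ j = f' ≫ v :=
    ⟨h0.desc i (f' ≫ v) (by rw [h.w, Category.assoc]), h0.inl_desc _ _ _, h0.inr_desc _ _ _⟩
  subst hj1
  have h1 : IsPushout v₀ f' j v := IsPushout.of_top h hj2 h0
  have hj : SemiStableKer j := hf'.of_isPushout h1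
  have hi := (hf.of_isPushout h0).isSomeKer
  obtain ⟨B, q, hq⟩ := exists_isCoker i₀
  have hi' := isKer_iff.1 (hi.isKer hq)
  have h2 := IsPushout.of_hasPushout q j
  set k := pushout.inl q j
  set c := pushout.inr q j
  obtain ⟨W, l, hl⟩ := hj _ _ _ h2
  have hk := (isKer_iff.1 hl).2.1
  obtain ⟨R, r, hr⟩ := exists_isCoker j
  have hjr := isKer_iff.1 (hj.isSomeKer.isKer hr)
  obtain ⟨d, hd1, hd2⟩ : ∃ d, k ≫ d = 0 ∧ c ≫ d = r :=
    ⟨h2.desc 0 r (by rw [comp_zero, hjr.1]), h2.inl_desc _ _ _, h2.inr_desc _ _ _⟩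
  refine ⟨_, c, isKer_iff.2 ⟨?_, ?_, fun t ht => ?_⟩⟩
  · rw [Category.assoc, ← h2.w, ← Category.assoc, hi'.1, zero_comp]
  · have := hi'.2.1
    have := hjr.2.1
    exact mono_comp _ _
  · obtain ⟨t', rfl⟩ := hjr.2.2 t (by rw [← hd2, ← Category.assoc, ht, zero_comp])
    obtain ⟨u, rfl⟩ := hi'.2.2 t' (by
      rw [← cancel_mono k, zero_comp, Category.assoc, h2.w, ← Category.assoc, ht])
    exact ⟨u, (Category.assoc _ _ _).symm⟩

theorem SemiStableCoker.comp [HasPullbacks C] [HasKernels C] {X Y Z : C} {g' : X ⟶ Y} {g : Y ⟶ Z}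
    (hg' : SemiStableCoker g') (hg : SemiStableCoker g) : SemiStableCoker (g' ≫ g) := by
  intro Z' P a v i h
  have h0 := IsPullback.of_hasPullback g a
  set i₀ := pullback.snd g a
  set v₀ := pullback.fst g a
  obtain ⟨j, hj1, hj2⟩ : ∃ j, j ≫ i₀ = i ∧ j ≫ v₀ = v ≫ g' :=
    ⟨h0.lift (v ≫ g') i (by rw [← h.w, Category.assoc]), h0.lift_snd _ _ _, h0.lift_fst _ _ _⟩
  subst hj1
  have h1 : IsPullback v j g' v₀ := (IsPullback.of_right h.flip hj2 h0.flip).flip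
  have hj : SemiStableCoker j := hg'.of_isPullback h1
  have hi := (hg.of_isPullback h0).isSomeCoker
  obtain ⟨B, q, hq⟩ := exists_isKer i₀
  have hi' := isCoker_iff.1 (hi.isCoker hq)
  have h2 := IsPullback.of_hasPullback j q
  set k := pullback.snd j q
  set c := pullback.fst j q
  obtain ⟨W, l, hl⟩ := hj _ _ _ h2
  have hk := (isCoker_iff.1 hl).2.1
  obtain ⟨R, r, hr⟩ := exists_isKer j
  have hjr := isCoker_iff.1 (hj.isSomeCoker.isCoker hr)
  obtain ⟨d, hd1, hd2⟩ : ∃ d, d ≫ k = 0 ∧ d ≫ c = r :=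
    ⟨h2.lift r 0 (by rw [zero_comp, hjr.1]), h2.lift_snd _ _ _, h2.lift_fst _ _ _⟩
  refine ⟨_, c, isCoker_iff.2 ⟨?_, ?_, fun t ht => ?_⟩⟩
  · rw [← Category.assoc, h2.w, Category.assoc, hi'.1, comp_zero]
  · have := hi'.2.1
    have := hjr.2.1
    exact epi_comp _ _
  · obtain ⟨t', rfl⟩ := hjr.2.2 t (by rw [← hd2, Category.assoc, ht, comp_zero])
    obtain ⟨u, rfl⟩ := hi'.2.2 t' (by
      rw [← cancel_epi k, comp_zero, ← Category.assoc, ← h2.w, Category.assoc, ht])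
    exact ⟨u, Category.assoc _ _ _⟩

theorem semiStableKer_of_isSplitMono {X Y : C} (f : X ⟶ Y) [IsSplitMono f] : SemiStableKer f := by
  intro X' P a i v h
  obtain ⟨r, hr1, -⟩ : ∃ r, i ≫ r = 𝟙 X' ∧ v ≫ r = retraction f ≫ a :=
    ⟨h.desc (𝟙 X') (retraction f ≫ a) (by simp), h.inl_desc _ _ _, h.inr_desc _ _ _⟩
  refine ⟨P, 𝟙 P - r ≫ i, isKer_iff.2 ⟨?_, ?_, fun t ht => ⟨t ≫ r, ?_⟩⟩⟩
  · rw [Preadditive.comp_sub, ← Category.assoc, hr1, Category.comp_id, Category.id_comp, sub_self]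
  · exact mono_of_mono_fac hr1
  · rw [Preadditive.comp_sub, Category.comp_id, sub_eq_zero] at ht
    rw [Category.assoc, ← ht]

theorem semiStableCoker_of_isSplitEpi {Y Z : C} (g : Y ⟶ Z) [IsSplitEpi g] :
    SemiStableCoker g := by
  intro Z' P b v p h
  obtain ⟨s, -, hs⟩ : ∃ s, s ≫ v = b ≫ section_ g ∧ s ≫ p = 𝟙 Z' :=
    ⟨h.lift (b ≫ section_ g) (𝟙 Z') (by simp), h.lift_fst _ _ _, h.lift_snd _ _ _⟩
  refine ⟨P, 𝟙 P - p ≫ s, isCoker_iff.2 ⟨?_, ?_, fun t ht => ⟨s ≫ t, ?_⟩⟩⟩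
  · rw [Preadditive.sub_comp, Category.assoc, hs, Category.comp_id, Category.id_comp, sub_self]
  · exact epi_of_epi_fac hs
  · rw [Preadditive.sub_comp, Category.id_comp, sub_eq_zero] at ht
    rw [← Category.assoc, ← ht]

section Biprod

variable [HasBinaryBiproducts C]

theorem isKer_inl_snd (X Z : C) :
    IsKer (biprod.inl : X ⟶ X ⊞ Z) (biprod.snd : X ⊞ Z ⟶ Z) :=
  isKer_iff.2 ⟨biprod.inl_snd, inferInstance, fun t ht => ⟨t ≫ biprod.fst, by
    apply biprod.hom_ext <;> simp [ht]⟩⟩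

theorem isCoker_inl_snd (X Z : C) :
    IsCoker (biprod.inl : X ⟶ X ⊞ Z) (biprod.snd : X ⊞ Z ⟶ Z) :=
  isCoker_iff.2 ⟨biprod.inl_snd, inferInstance, fun t ht => ⟨biprod.inr ≫ t, by
    apply biprod.hom_ext' <;> simp [ht]⟩⟩

theorem map_comp_desc {X Y X' Y' T : C} (a : X ⟶ X') (b : Y ⟶ Y') (c : X' ⟶ T) (d : Y' ⟶ T) :
    biprod.map a b ≫ biprod.desc c d = biprod.desc (a ≫ c) (b ≫ d) := by
  ext <;> simp

theorem isPushout_map_id {X Y : C} (f : X ⟶ Y) (W : C) :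
    IsPushout (biprod.inl : X ⟶ X ⊞ W) f (biprod.map f (𝟙 W)) biprod.inl :=
  ⟨⟨by simp⟩, ⟨PushoutCocone.IsColimit.mk _
    (fun s => biprod.desc s.inr (biprod.inr ≫ s.inl))
    (fun s => by ext <;> simp [s.condition]) (fun s => by simp)
    (fun s m h1 h2 => by ext <;> simp [← h1, ← h2])⟩⟩

theorem isPushout_id_map {X Y : C} (f : X ⟶ Y) (W : C) :
    IsPushout (biprod.inr : X ⟶ W ⊞ X) f (biprod.map (𝟙 W) f) biprod.inr :=
  ⟨⟨by simp⟩, ⟨PushoutCocone.IsColimit.mk _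
    (fun s => biprod.desc (biprod.inl ≫ s.inl) s.inr)
    (fun s => by ext <;> simp [s.condition]) (fun s => by simp)
    (fun s m h1 h2 => by ext <;> simp [← h1, ← h2])⟩⟩

theorem isPullback_map_id {Y Z : C} (g : Y ⟶ Z) (W : C) :
    IsPullback biprod.fst (biprod.map g (𝟙 W)) g (biprod.fst : Z ⊞ W ⟶ Z) :=
  ⟨⟨by simp⟩, ⟨PullbackCone.IsLimit.mk _
    (fun s => biprod.lift s.fst (s.snd ≫ biprod.snd))
    (fun s => by simp) (fun s => by ext <;> simp [s.condition])
    (fun s m h1 h2 => by ext <;> simp [← h1, ← h2])⟩⟩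

theorem isPullback_id_map {Y Z : C} (g : Y ⟶ Z) (W : C) :
    IsPullback biprod.snd (biprod.map (𝟙 W) g) g (biprod.snd : W ⊞ Z ⟶ Z) :=
  ⟨⟨by simp⟩, ⟨PullbackCone.IsLimit.mk _
    (fun s => biprod.lift (s.snd ≫ biprod.fst) s.fst)
    (fun s => by simp) (fun s => by ext <;> simp [s.condition])
    (fun s m h1 h2 => by ext <;> simp [← h1, ← h2])⟩⟩

theorem SemiStableKer.map [HasPushouts C] [HasCokernels C] {X Y X' Y' : C} {f : X ⟶ Y}
    {f' : X' ⟶ Y'} (hf : SemiStableKer f) (hf' : SemiStableKer f') :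
    SemiStableKer (biprod.map f f') := by
  have : biprod.map f f' = biprod.map f (𝟙 X') ≫ biprod.map (𝟙 Y) f' := by ext <;> simp
  rw [this]
  exact SemiStableKer.comp (hf.of_isPushout (isPushout_map_id f X'))
    (hf'.of_isPushout (isPushout_id_map f' Y))

theorem SemiStableCoker.map [HasPullbacks C] [HasKernels C] {X Y X' Y' : C} {f : X ⟶ Y}
    {f' : X' ⟶ Y'} (hf : SemiStableCoker f) (hf' : SemiStableCoker f') :
    SemiStableCoker (biprod.map f f') := by
  have : biprod.map f f' = biprod.map f (𝟙 X') ≫ biprod.map (𝟙 Y) f' := by ext <;> simp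
  rw [this]
  exact SemiStableCoker.comp (hf.of_isPullback (isPullback_map_id f X'))
    (hf'.of_isPullback (isPullback_id_map f' Y))

theorem isKer_map {X Y Z X' Y' Z' : C} {f : X ⟶ Y} {g : Y ⟶ Z} {f' : X' ⟶ Y'} {g' : Y' ⟶ Z'}
    (h : IsKer f g) (h' : IsKer f' g') : IsKer (biprod.map f f') (biprod.map g g') := by
  rw [isKer_iff] at h h' ⊢
  have := h.2.1
  have := h'.2.1
  refine ⟨by ext <;> simp [h.1, h'.1], ⟨fun a b hab => ?_⟩, fun t ht => ?_⟩
  · ext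
    · rw [← cancel_mono f]; simpa using hab =≫ biprod.fst
    · rw [← cancel_mono f']; simpa using hab =≫ biprod.snd
  · obtain ⟨x, hx⟩ := h.2.2 (t ≫ biprod.fst) (by simpa using ht =≫ biprod.fst)
    obtain ⟨y, hy⟩ := h'.2.2 (t ≫ biprod.snd) (by simpa using ht =≫ biprod.snd)
    exact ⟨biprod.lift x y, by ext <;> simp [hx, hy]⟩

theorem isCoker_map {X Y Z X' Y' Z' : C} {f : X ⟶ Y} {g : Y ⟶ Z} {f' : X' ⟶ Y'} {g' : Y' ⟶ Z'}
    (h : IsCoker f g) (h' : IsCoker f' g') : IsCoker (biprod.map f f') (biprod.map g g') := by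
  rw [isCoker_iff] at h h' ⊢
  have := h.2.1
  have := h'.2.1
  refine ⟨by ext <;> simp [h.1, h'.1], ⟨fun a b hab => ?_⟩, fun t ht => ?_⟩
  · ext
    · rw [← cancel_epi g]; simpa using biprod.inl ≫= hab
    · rw [← cancel_epi g']; simpa using biprod.inr ≫= hab
  · obtain ⟨x, hx⟩ := h.2.2 (biprod.inl ≫ t) (by simpa using biprod.inl ≫= ht)
    obtain ⟨y, hy⟩ := h'.2.2 (biprod.inr ≫ t) (by simpa using biprod.inr ≫= ht)
    exact ⟨biprod.desc x y, by ext <;> simp [hx, hy]⟩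

theorem exists_inverse {X Z P Q : C} {f₂ : X ⟶ P} {g₂ : P ⟶ Z} {f₃ : X ⟶ Q} {g₃ : Q ⟶ Z}
    (h₂ : IsKer f₂ g₂) (hg₂ : SemiStableCoker g₂) (h₃ : IsKer f₃ g₃) (φ : P ⟶ Q)
    (hf : f₂ ≫ φ = f₃) (hg : φ ≫ g₃ = g₂) :
    ∃ ψ : Q ⟶ P, φ ≫ ψ = 𝟙 P ∧ ψ ≫ φ = 𝟙 Q := by
  rw [isKer_iff] at h₂ h₃
  have := h₃.2.1
  have hP : IsPullback (biprod.snd : X ⊞ P ⟶ P) (biprod.desc f₃ φ) g₂ g₃ := by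
    have key : ∀ s : PullbackCone g₂ g₃, ∃ x, x ≫ f₃ = s.snd - s.fst ≫ φ := fun s =>
      h₃.2.2 _ (by rw [Preadditive.sub_comp, Category.assoc, hg, s.condition, sub_self])
    choose x hx using key
    refine ⟨⟨by ext <;> simp [h₃.1, hg]⟩, ⟨PullbackCone.IsLimit.mk _
      (fun s => biprod.lift (x s) s.fst) (fun s => by simp) (fun s => by simp [hx])
      (fun s m h1 h2 => ?_)⟩⟩
    ext
    · rw [← cancel_mono f₃, biprod.lift_fst, hx, ← h1, ← h2, Category.assoc, Category.assoc,
        ← Preadditive.comp_sub]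
      congr 1
      ext <;> simp
    · simpa using h1
  obtain ⟨W, k, hk⟩ := hg₂ _ _ _ hP
  rw [isCoker_iff] at hk
  have hk1 : (k ≫ biprod.fst) ≫ f₃ + (k ≫ biprod.snd) ≫ φ = 0 := by
    rw [← hk.1, biprod.desc_eq]; simp
  obtain ⟨y, hy⟩ := h₂.2.2 (k ≫ biprod.snd) (by
    have := hk1 =≫ g₃
    simpa [h₃.1, hg] using this)
  have hy' : k ≫ biprod.fst = - y := by
    rw [← cancel_mono f₃, Preadditive.neg_comp, eq_neg_iff_add_eq_zero, ← hf,
      ← Category.assoc y, hy, hf, hk1]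
  obtain ⟨ψ, hψ⟩ := hk.2.2 (biprod.desc f₂ (𝟙 P)) (by
    rw [biprod.desc_eq, Preadditive.comp_add, ← Category.assoc, hy', ← Category.assoc, ← hy]
    simp)
  have e1 : f₃ ≫ ψ = f₂ := by simpa using biprod.inl ≫= hψ
  have e2 : φ ≫ ψ = 𝟙 P := by simpa using biprod.inr ≫= hψ
  refine ⟨ψ, e2, ?_⟩
  have := hk.2.1
  rw [← cancel_epi (biprod.desc f₃ φ)]
  ext
  · simp [reassoc_of% e1, hf]
  · simp [reassoc_of% e2]

end Biprod
end Stability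
end SemiAb

namespace SemiAb

section Ext

variable {C : Type u} [Category.{v} C] [Preadditive C]

/-- A complex `X ⟶ Y ⟶ Z` with prescribed end-terms `X` and `Z`. -/
structure Cplx (X Z : C) where
  Y : C
  f : X ⟶ Y
  g : Y ⟶ Z
  w : f ≫ g = 0

namespace Cplx

/-- `X ⟶ Y ⟶ Z` is short exact: `f` is a kernel of `g` and `g` is a cokernel of `f`. -/
def IsShortExact {X Z : C} (ξ : Cplx X Z) : Prop := IsKer ξ.f ξ.g ∧ IsCoker ξ.f ξ.g

/-- Isomorphism of complexes which is the identity on both end-terms. -/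
def Equivalent {X Z : C} (ξ η : Cplx X Z) : Prop :=
  ∃ e : ξ.Y ≅ η.Y, ξ.f ≫ e.hom = η.f ∧ e.hom ≫ η.g = ξ.g

/-- There is a morphism of complexes `(a, v, b) : ξ ⟶ η` for some `v`. -/
def HasMap {X Z X' Z' : C} (a : X ⟶ X') (b : Z ⟶ Z') (ξ : Cplx X Z) (η : Cplx X' Z') : Prop :=
  ∃ v : ξ.Y ⟶ η.Y, ξ.f ≫ v = a ≫ η.f ∧ v ≫ η.g = ξ.g ≫ b

theorem HasMap.comp {X Z X' Z' X'' Z'' : C} {a : X ⟶ X'} {b : Z ⟶ Z'} {a' : X' ⟶ X''}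
    {b' : Z' ⟶ Z''} {ξ : Cplx X Z} {η : Cplx X' Z'} {ζ : Cplx X'' Z''} (h : HasMap a b ξ η)
    (h' : HasMap a' b' η ζ) : HasMap (a ≫ a') (b ≫ b') ξ ζ := by
  obtain ⟨v, h1, h2⟩ := h
  obtain ⟨v', h1', h2'⟩ := h'
  exact ⟨v ≫ v', by rw [reassoc_of% h1, h1', Category.assoc],
    by rw [Category.assoc, h2', reassoc_of% h2]⟩

theorem HasMap.refl {X Z : C} (ξ : Cplx X Z) : HasMap (𝟙 X) (𝟙 Z) ξ ξ :=
  ⟨𝟙 _, by simp, by simp⟩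

theorem Equivalent.hasMap {X Z : C} {ξ η : Cplx X Z} (h : Equivalent ξ η) :
    HasMap (𝟙 X) (𝟙 Z) ξ η := by
  obtain ⟨e, h1, h2⟩ := h
  exact ⟨e.hom, by simp [h1], by simp [h2]⟩

variable [Preabelian C]

/-- The complex `a ξ`: push out `f` along `a : X ⟶ X'`. -/
noncomputable def push {X X' Z : C} (a : X ⟶ X') (ξ : Cplx X Z) : Cplx X' Z where
  Y := pushout a ξ.f
  f := pushout.inl a ξ.f
  g := pushout.desc 0 ξ.g (by rw [comp_zero, ξ.w])
  w := pushout.inl_desc _ _ _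

/-- The complex `ξ b`: pull back `g` along `b : Z' ⟶ Z`. -/
noncomputable def pull {X Z' Z : C} (ξ : Cplx X Z) (b : Z' ⟶ Z) : Cplx X Z' where
  Y := pullback ξ.g b
  f := pullback.lift ξ.f 0 (by rw [zero_comp, ξ.w])
  g := pullback.snd ξ.g b
  w := pullback.lift_snd _ _ _

/-- The direct sum `ξ ⊕ ξ'`. -/
noncomputable def dsum {X Z X' Z' : C} (ξ : Cplx X Z) (ξ' : Cplx X' Z') :
    Cplx (X ⊞ X') (Z ⊞ Z') where
  Y := ξ.Y ⊞ ξ'.Y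
  f := biprod.map ξ.f ξ'.f
  g := biprod.map ξ.g ξ'.g
  w := by ext <;> simp [ξ.w, ξ'.w]

/-- The split complex `X ⟶ X ⊕ Z ⟶ Z`. -/
noncomputable def split (X Z : C) : Cplx X Z where
  Y := X ⊞ Z
  f := biprod.inl
  g := biprod.snd
  w := biprod.inl_snd

/-- A short exact sequence `ξ` is stable if all `a ξ` and all `ξ b` are short exact. -/
structure IsStable {X Z : C} (ξ : Cplx X Z) : Prop where
  shortExact : ξ.IsShortExact
  push : ∀ {X' : C} (a : X ⟶ X'), (ξ.push a).IsShortExact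
  pull : ∀ {Z' : C} (b : Z' ⟶ Z), (ξ.pull b).IsShortExact

theorem push_spec {X X' Z : C} (a : X ⟶ X') (ξ : Cplx X Z) :
    ∃ v : ξ.Y ⟶ (ξ.push a).Y, IsPushout a ξ.f (ξ.push a).f v ∧ v ≫ (ξ.push a).g = ξ.g :=
  ⟨pushout.inr a ξ.f, IsPushout.of_hasPushout a ξ.f, pushout.inr_desc _ _ _⟩

theorem pull_spec {X Z' Z : C} (ξ : Cplx X Z) (b : Z' ⟶ Z) :
    ∃ v : (ξ.pull b).Y ⟶ ξ.Y, IsPullback v (ξ.pull b).g ξ.g b ∧ (ξ.pull b).f ≫ v = ξ.f :=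
  ⟨pullback.fst ξ.g b, IsPullback.of_hasPullback ξ.g b, pullback.lift_fst _ _ _⟩

theorem isStable_iff {X Z : C} {ξ : Cplx X Z} :
    ξ.IsStable ↔ ξ.IsShortExact ∧ SemiStableKer ξ.f ∧ SemiStableCoker ξ.g := by
  constructor
  · intro h
    refine ⟨h.shortExact, fun X' P a i v hp => ?_, fun Z' P b v p hp => ?_⟩
    · obtain ⟨w, m, hm'⟩ := isKer_iff.1 (h.push a).1
      obtain ⟨v', h0, -⟩ := ξ.push_spec a
      let e := h0.isoIsPushout _ _ hp
      have he : (ξ.push a).f ≫ e.hom = i := IsPushout.inl_isoIsPushout_hom _ _ _ _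
      have hi : i ≫ e.inv = (ξ.push a).f := by rw [← he]; simp
      refine ⟨Z, e.inv ≫ (ξ.push a).g, isKer_iff.2 ⟨by rw [reassoc_of% hi, w], ?_, fun t ht => ?_⟩⟩
      · exact mono_of_mono_fac hi
      · obtain ⟨u, hu⟩ := hm' (t ≫ e.inv) (by rw [Category.assoc, ht])
        exact ⟨u, by rw [← cancel_mono e.inv, Category.assoc, hi, hu]⟩
    · obtain ⟨w, m, hm'⟩ := isCoker_iff.1 (h.pull b).2
      obtain ⟨v', h0, -⟩ := ξ.pull_spec b
      let e := h0.isoIsPullback _ _ hp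
      have hi : e.hom ≫ p = (ξ.pull b).g := IsPullback.isoIsPullback_hom_snd _ _ _ _
      refine ⟨X, (ξ.pull b).f ≫ e.hom, isCoker_iff.2 ⟨by rw [Category.assoc, hi, w], ?_,
        fun t ht => ?_⟩⟩
      · exact epi_of_epi_fac hi
      · obtain ⟨u, hu⟩ := hm' (e.hom ≫ t) (by rw [← Category.assoc, ht])
        exact ⟨u, by rw [← cancel_epi e.hom, ← Category.assoc, hi, hu]⟩
  · rintro ⟨hs, hf, hg⟩
    refine ⟨hs, fun a => ?_, fun b => ?_⟩
    · obtain ⟨v, hp, hv⟩ := ξ.push_spec a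
      have hc : IsCoker (ξ.push a).f (ξ.push a).g :=
        isCoker_of_isPushout hp hs.2 (ξ.push a).w hv
      exact ⟨(hf _ _ _ hp).isKer hc, hc⟩
    · obtain ⟨v, hp, hv⟩ := ξ.pull_spec b
      have hk : IsKer (ξ.pull b).f (ξ.pull b).g :=
        isKer_of_isPullback hp hs.1 (ξ.pull b).w hv
      exact ⟨hk, (hg _ _ _ hp).isCoker hk⟩

theorem IsStable.pushStable {X X' Z : C} {ξ : Cplx X Z} (h : ξ.IsStable) (a : X ⟶ X') :
    (ξ.push a).IsStable := by
  have h' := isStable_iff.1 h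
  obtain ⟨v, hp, hv⟩ := ξ.push_spec a
  exact isStable_iff.2 ⟨h.push a, h'.2.1.of_isPushout hp,
    SemiStableCoker.of_comp (b' := v) (by rw [hv]; exact h'.2.2)⟩

theorem IsStable.pullStable {X Z' Z : C} {ξ : Cplx X Z} (h : ξ.IsStable) (b : Z' ⟶ Z) :
    (ξ.pull b).IsStable := by
  have h' := isStable_iff.1 h
  obtain ⟨v, hp, hv⟩ := ξ.pull_spec b
  exact isStable_iff.2 ⟨h.pull b, SemiStableKer.of_comp (b' := v) (by rw [hv]; exact h'.2.1),
    h'.2.2.of_isPullback hp⟩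

theorem IsStable.dsumStable {X Z X' Z' : C} {ξ : Cplx X Z} {ξ' : Cplx X' Z'} (h : ξ.IsStable)
    (h' : ξ'.IsStable) : (ξ.dsum ξ').IsStable := by
  rw [isStable_iff] at h h' ⊢
  exact ⟨⟨isKer_map h.1.1 h'.1.1, isCoker_map h.1.2 h'.1.2⟩, h.2.1.map h'.2.1, h.2.2.map h'.2.2⟩

theorem split_isStable (X Z : C) : (split X Z).IsStable :=
  isStable_iff.2 ⟨⟨isKer_inl_snd X Z, isCoker_inl_snd X Z⟩,
    semiStableKer_of_isSplitMono (biprod.inl : X ⟶ X ⊞ Z),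
    semiStableCoker_of_isSplitEpi (biprod.snd : X ⊞ Z ⟶ Z)⟩

theorem hasMap_push {X X' Z : C} (a : X ⟶ X') (ξ : Cplx X Z) : HasMap a (𝟙 Z) ξ (ξ.push a) := by
  obtain ⟨v, hp, hv⟩ := ξ.push_spec a
  exact ⟨v, hp.w.symm, by rw [hv, Category.comp_id]⟩

theorem pull_hasMap {X Z' Z : C} (ξ : Cplx X Z) (b : Z' ⟶ Z) : HasMap (𝟙 X) b (ξ.pull b) ξ := by
  obtain ⟨v, hp, hv⟩ := ξ.pull_spec b
  exact ⟨v, by rw [hv, Category.id_comp], hp.w⟩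

theorem HasMap.of_push {X Z X' X'' Z'' : C} {a : X ⟶ X'} {a' : X' ⟶ X''} {b : Z ⟶ Z''}
    {ξ : Cplx X Z} {η : Cplx X'' Z''} (h : HasMap (a ≫ a') b ξ η) :
    HasMap a' b (ξ.push a) η := by
  obtain ⟨v, h1, h2⟩ := h
  obtain ⟨v', hp, hv⟩ := ξ.push_spec a
  have hw : a ≫ a' ≫ η.f = ξ.f ≫ v := by rw [h1, Category.assoc]
  refine ⟨hp.desc (a' ≫ η.f) v hw, hp.inl_desc _ _ _, hp.hom_ext ?_ ?_⟩
  · rw [hp.inl_desc_assoc, Category.assoc, η.w, comp_zero, ← Category.assoc, (ξ.push a).w,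
      zero_comp]
  · rw [hp.inr_desc_assoc, h2, reassoc_of% hv]

theorem HasMap.to_pull {X Z X' Z' Z'' : C} {a : X ⟶ X'} {b : Z ⟶ Z'} {b' : Z' ⟶ Z''}
    {ξ : Cplx X Z} {η : Cplx X' Z''} (h : HasMap a (b ≫ b') ξ η) :
    HasMap a b ξ (η.pull b') := by
  obtain ⟨v, h1, h2⟩ := h
  obtain ⟨v', hp, hv⟩ := η.pull_spec b'
  have hw : v ≫ η.g = (ξ.g ≫ b) ≫ b' := by rw [h2, Category.assoc]
  refine ⟨hp.lift v (ξ.g ≫ b) hw, hp.hom_ext ?_ ?_, hp.lift_snd _ _ _⟩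
  · rw [Category.assoc, hp.lift_fst, h1, Category.assoc, hv]
  · rw [Category.assoc, hp.lift_snd, Category.assoc, (η.pull b').w, comp_zero, ← Category.assoc,
      ξ.w, zero_comp]

theorem HasMap.equivalent {X Z : C} {ξ η : Cplx X Z} (hξ : ξ.IsStable) (hη : η.IsStable)
    (h : HasMap (𝟙 X) (𝟙 Z) ξ η) : Equivalent ξ η := by
  obtain ⟨φ, h1, h2⟩ := h
  rw [Category.id_comp] at h1
  rw [Category.comp_id] at h2
  obtain ⟨ψ, e1, e2⟩ := exists_inverse hξ.shortExact.1 (isStable_iff.1 hξ).2.2 hη.shortExact.1 φ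
    h1 h2
  exact ⟨⟨φ, ψ, e1, e2⟩, h1, h2⟩

end Cplx

variable [Preabelian C]

/-- Equivalence of stable exact sequences with end-terms `X` and `Z`. -/
def stableSetoid (Z X : C) : Setoid {ξ : Cplx X Z // ξ.IsStable} where
  r ξ η := Cplx.Equivalent ξ.1 η.1
  iseqv :=
    ⟨fun ξ => ⟨Iso.refl _, Category.comp_id _, Category.id_comp _⟩,
      fun ⟨e, h1, h2⟩ => ⟨e.symm, by simp [← h1], by simp [← h2]⟩,
      fun ⟨e, h1, h2⟩ ⟨e', h1', h2'⟩ => ⟨e ≪≫ e', by simp [reassoc_of% h1, h1'],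
        by simp [h2', h2]⟩⟩

/-- `Ext¹(Z, X)`: equivalence classes of stable exact sequences `X ⟶ Y ⟶ Z`. -/
def Ext1 (Z X : C) : Type (max u v) := Quotient (stableSetoid Z X)

namespace Ext1

/-- The class of a stable exact sequence. -/
def mk {Z X : C} (ξ : Cplx X Z) (h : ξ.IsStable) : Ext1 Z X :=
  Quotient.mk (stableSetoid Z X) ⟨ξ, h⟩

theorem ind {Z X : C} {p : Ext1 Z X → Prop} (h : ∀ ξ hξ, p (mk ξ hξ)) (x : Ext1 Z X) : p x :=
  Quotient.ind (fun ξ => h ξ.1 ξ.2) x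

theorem mk_eq {Z X : C} {ξ η : Cplx X Z} {hξ : ξ.IsStable} {hη : η.IsStable}
    (h : Cplx.HasMap (𝟙 X) (𝟙 Z) ξ η) : mk ξ hξ = mk η hη :=
  Quotient.sound (h.equivalent hξ hη)

/-- `ξ ↦ a ξ`. -/
noncomputable def push {Z X X' : C} (a : X ⟶ X') : Ext1 Z X → Ext1 Z X' :=
  Quotient.lift (fun ξ => mk (ξ.1.push a) (ξ.2.pushStable a)) fun _ η h => mk_eq
    (.of_push (by simpa using (Cplx.Equivalent.hasMap h).comp (η.1.hasMap_push a)))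

/-- `ξ ↦ ξ b`. -/
noncomputable def pull {Z' Z X : C} (b : Z' ⟶ Z) : Ext1 Z X → Ext1 Z' X :=
  Quotient.lift (fun ξ => mk (ξ.1.pull b) (ξ.2.pullStable b)) fun ξ _ h => mk_eq
    (.to_pull (by simpa using (ξ.1.pull_hasMap b).comp (Cplx.Equivalent.hasMap h)))

theorem dsum_hasMap {X Z X' Z' X₁ Z₁ X₁' Z₁' : C} {ξ : Cplx X Z} {ξ' : Cplx X' Z'}
    {η : Cplx X₁ Z₁} {η' : Cplx X₁' Z₁'} {a : X ⟶ X₁} {b : Z ⟶ Z₁} {a' : X' ⟶ X₁'}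
    {b' : Z' ⟶ Z₁'} (h : Cplx.HasMap a b ξ η) (h' : Cplx.HasMap a' b' ξ' η') :
    Cplx.HasMap (biprod.map a a') (biprod.map b b') (ξ.dsum ξ') (η.dsum η') := by
  obtain ⟨v, h1, h2⟩ := h
  obtain ⟨v', h1', h2'⟩ := h'
  exact ⟨biprod.map v v', by simp only [Cplx.dsum]; ext <;> simp [h1, h1'],
    by simp only [Cplx.dsum]; ext <;> simp [h2, h2']⟩

theorem map_id_id (A B : C) : biprod.map (𝟙 A) (𝟙 B) = 𝟙 (A ⊞ B) := by ext <;> simp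

/-- `(ξ, ξ') ↦ ξ ⊕ ξ'`. -/
noncomputable def dsum {Z X Z' X' : C} : Ext1 Z X → Ext1 Z' X' → Ext1 (Z ⊞ Z') (X ⊞ X') :=
  Quotient.lift₂ (fun ξ ξ' => mk (ξ.1.dsum ξ'.1) (ξ.2.dsumStable ξ'.2)) fun _ _ _ _ h h' => mk_eq
    (by simpa only [map_id_id] using dsum_hasMap (Cplx.Equivalent.hasMap h) (Cplx.Equivalent.hasMap h'))

theorem push_mk_eq_pull_mk {Z X Z' X' : C} {ξ : Cplx X Z} {η : Cplx X' Z'} (hξ : ξ.IsStable)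
    (hη : η.IsStable) {a : X ⟶ X'} {b : Z ⟶ Z'} (h : Cplx.HasMap a b ξ η) :
    push a (mk ξ hξ) = pull b (mk η hη) :=
  mk_eq (.of_push (.to_pull (by simpa using h)))

theorem pull_id {Z X : C} (x : Ext1 Z X) : pull (𝟙 Z) x = x := by
  induction x using ind with | h ξ hξ =>
  exact mk_eq (ξ.pull_hasMap (𝟙 Z))

theorem push_id {Z X : C} (x : Ext1 Z X) : push (𝟙 X) x = x := by
  induction x using ind with | h ξ hξ =>
  exact (mk_eq (ξ.hasMap_push (𝟙 X))).symm

theorem push_mk_eq {Z X X' : C} {ξ : Cplx X Z} {η : Cplx X' Z} (hξ : ξ.IsStable)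
    (hη : η.IsStable) {a : X ⟶ X'} (h : Cplx.HasMap a (𝟙 Z) ξ η) : push a (mk ξ hξ) = mk η hη := by
  rw [push_mk_eq_pull_mk hξ hη h, pull_id]

theorem pull_mk_eq {Z Z' X : C} {ξ : Cplx X Z} {η : Cplx X Z'} (hξ : ξ.IsStable)
    (hη : η.IsStable) {b : Z ⟶ Z'} (h : Cplx.HasMap (𝟙 X) b ξ η) : pull b (mk η hη) = mk ξ hξ := by
  rw [← push_mk_eq_pull_mk hξ hη h, push_id]

theorem push_comp {Z X X' X'' : C} (a : X ⟶ X') (a' : X' ⟶ X'') (x : Ext1 Z X) :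
    push (a ≫ a') x = push a' (push a x) := by
  induction x using ind with | h ξ hξ =>
  exact push_mk_eq _ _ (by simpa using (ξ.hasMap_push a).comp ((ξ.push a).hasMap_push a'))

theorem pull_comp {Z'' Z' Z X : C} (b' : Z'' ⟶ Z') (b : Z' ⟶ Z) (x : Ext1 Z X) :
    pull (b' ≫ b) x = pull b' (pull b x) := by
  induction x using ind with | h ξ hξ =>
  exact pull_mk_eq _ _ (by simpa using ((ξ.pull b).pull_hasMap b').comp (ξ.pull_hasMap b))

theorem push_pull {Z' Z X X' : C} (a : X ⟶ X') (b : Z' ⟶ Z) (x : Ext1 Z X) :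
    push a (pull b x) = pull b (push a x) := by
  induction x using ind with | h ξ hξ =>
  exact push_mk_eq_pull_mk _ _ (by simpa using (ξ.pull_hasMap b).comp (ξ.hasMap_push a))

theorem push_map_dsum {Z Z' X X' X₁ X₁' : C} (a : X ⟶ X₁) (a' : X' ⟶ X₁') (x : Ext1 Z X)
    (y : Ext1 Z' X') : push (biprod.map a a') (dsum x y) = dsum (push a x) (push a' y) := by
  induction x using ind with | h ξ hξ =>
  induction y using ind with | h η hη =>
  exact push_mk_eq _ _ (by simpa only [map_id_id] using dsum_hasMap (ξ.hasMap_push a) (η.hasMap_push a'))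

theorem pull_map_dsum {Z Z' X X' Z₁ Z₁' : C} (b : Z₁ ⟶ Z) (b' : Z₁' ⟶ Z') (x : Ext1 Z X)
    (y : Ext1 Z' X') : pull (biprod.map b b') (dsum x y) = dsum (pull b x) (pull b' y) := by
  induction x using ind with | h ξ hξ =>
  induction y using ind with | h η hη =>
  exact pull_mk_eq _ _ (by simpa only [map_id_id] using dsum_hasMap (ξ.pull_hasMap b) (η.pull_hasMap b'))

/-- The diagonal `Δ : A ⟶ A ⊕ A`. -/
noncomputable abbrev diag (A : C) : A ⟶ A ⊞ A := biprod.lift (𝟙 A) (𝟙 A)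

/-- The codiagonal `∇ : A ⊕ A ⟶ A`. -/
noncomputable abbrev codiag (A : C) : A ⊞ A ⟶ A := biprod.desc (𝟙 A) (𝟙 A)

theorem push_diag {Z X : C} (x : Ext1 Z X) : push (diag X) x = pull (diag Z) (dsum x x) := by
  induction x using ind with | h ξ hξ =>
  exact push_mk_eq_pull_mk _ _
    ⟨diag ξ.Y, by simp only [Cplx.dsum]; ext <;> simp, by simp only [Cplx.dsum]; ext <;> simp⟩

theorem push_codiag {Z X : C} (x : Ext1 Z X) :
    push (codiag X) (dsum x x) = pull (codiag Z) x := by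
  induction x using ind with | h ξ hξ =>
  exact push_mk_eq_pull_mk _ _
    ⟨codiag ξ.Y, by simp only [Cplx.dsum]; ext <;> simp, by simp only [Cplx.dsum]; ext <;> simp⟩

theorem push_braid {Z Z' X X' : C} (x : Ext1 Z X) (y : Ext1 Z' X') :
    push (biprod.braiding X X').hom (dsum x y) = pull (biprod.braiding Z Z').hom (dsum y x) := by
  induction x using ind with | h ξ hξ =>
  induction y using ind with | h η hη =>
  exact push_mk_eq_pull_mk _ _
    ⟨(biprod.braiding ξ.Y η.Y).hom, by simp only [Cplx.dsum]; ext <;> simp,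
      by simp only [Cplx.dsum]; ext <;> simp⟩

theorem push_assoc {Z Z' Z'' X X' X'' : C} (x : Ext1 Z X) (y : Ext1 Z' X') (z : Ext1 Z'' X'') :
    push (biprod.associator X X' X'').hom (dsum (dsum x y) z) =
      pull (biprod.associator Z Z' Z'').hom (dsum x (dsum y z)) := by
  induction x using ind with | h ξ hξ =>
  induction y using ind with | h η hη =>
  induction z using ind with | h ζ hζ =>
  exact push_mk_eq_pull_mk _ _
    ⟨(biprod.associator ξ.Y η.Y ζ.Y).hom, by simp only [Cplx.dsum]; ext <;> simp,
      by simp only [Cplx.dsum]; ext <;> simp⟩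

/-- The zero of `Ext¹(Z, X)` is the class of the split sequence. -/
noncomputable instance (Z X : C) : Zero (Ext1 Z X) :=
  ⟨mk (Cplx.split X Z) (Cplx.split_isStable X Z)⟩

/-- The Baer sum `ξ + ξ' = ∇ (ξ ⊕ ξ') Δ`. -/
noncomputable instance (Z X : C) : Add (Ext1 Z X) :=
  ⟨fun x y => pull (diag Z) (push (codiag X) (dsum x y))⟩

/-- The inverse of `ξ` is `(-1) ξ`. -/
noncomputable instance (Z X : C) : Neg (Ext1 Z X) := ⟨push (-𝟙 X)⟩

theorem add_def {Z X : C} (x y : Ext1 Z X) :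
    x + y = pull (diag Z) (push (codiag X) (dsum x y)) := rfl

theorem push_add {Z X X' : C} (a : X ⟶ X') (x y : Ext1 Z X) :
    push a (x + y) = push a x + push a y := by
  rw [add_def, add_def, push_pull, ← push_comp, ← push_map_dsum, ← push_comp]
  congr 2
  ext <;> simp

theorem pull_add {Z' Z X : C} (b : Z' ⟶ Z) (x y : Ext1 Z X) :
    pull b (x + y) = pull b x + pull b y := by
  rw [add_def, add_def, ← pull_comp, ← pull_map_dsum, push_pull, ← pull_comp]
  congr 1
  ext <;> simp

theorem add_push {Z X X' : C} (a b : X ⟶ X') (x : Ext1 Z X) :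
    push (a + b) x = push a x + push b x := by
  rw [add_def, ← push_map_dsum, ← push_comp, ← push_pull, ← push_diag, ← push_comp]
  congr 1
  rw [map_comp_desc, biprod.lift_desc]; simp

theorem add_pull {Z' Z X : C} (a b : Z' ⟶ Z) (x : Ext1 Z X) :
    pull (a + b) x = pull a x + pull b x := by
  rw [add_def, ← pull_map_dsum, push_pull, push_codiag, ← pull_comp, ← pull_comp]
  congr 1
  rw [Category.assoc, map_comp_desc, biprod.lift_desc]; simp

theorem push_zero {Z X X' : C} (x : Ext1 Z X) : push (0 : X ⟶ X') x = 0 := by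
  induction x using ind with | h ξ hξ =>
  have h1 : ξ.f ≫ ξ.g ≫ (biprod.inr : Z ⟶ X' ⊞ Z) = (0 : X ⟶ X') ≫ biprod.inl := by
    rw [← Category.assoc, ξ.w, zero_comp, zero_comp]
  have h2 : (ξ.g ≫ (biprod.inr : Z ⟶ X' ⊞ Z)) ≫ biprod.snd = ξ.g ≫ 𝟙 Z := by simp
  exact push_mk_eq _ _ ⟨_, h1, h2⟩

theorem pull_zero {Z' Z X : C} (x : Ext1 Z X) : pull (0 : Z' ⟶ Z) x = 0 := by
  induction x using ind with | h ξ hξ =>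
  have h1 : biprod.inl ≫ (biprod.fst : X ⊞ Z' ⟶ X) ≫ ξ.f = 𝟙 X ≫ ξ.f := by simp
  have h2 : ((biprod.fst : X ⊞ Z' ⟶ X) ≫ ξ.f) ≫ ξ.g = biprod.snd ≫ (0 : Z' ⟶ Z) := by
    rw [Category.assoc, ξ.w, comp_zero, comp_zero]
  exact pull_mk_eq _ _ ⟨_, h1, h2⟩

theorem add_comm' {Z X : C} (x y : Ext1 Z X) : x + y = y + x := by
  have h1 : codiag X = (biprod.braiding X X).hom ≫ codiag X := by ext <;> simp
  have h2 : diag Z = diag Z ≫ (biprod.braiding Z Z).hom := by ext <;> simp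
  rw [add_def, h1, push_comp, push_braid, push_pull, ← pull_comp, ← h2, add_def]

theorem add_assoc' {Z X : C} (x y z : Ext1 Z X) : x + y + z = x + (y + z) := by
  have e1 : dsum (x + y) z = pull (biprod.map (diag Z) (𝟙 Z))
      (push (biprod.map (codiag X) (𝟙 X)) (dsum (dsum x y) z)) := by
    rw [push_map_dsum, pull_map_dsum, push_id, pull_id, add_def]
  have e2 : dsum x (y + z) = pull (biprod.map (𝟙 Z) (diag Z))
      (push (biprod.map (𝟙 X) (codiag X)) (dsum x (dsum y z))) := by
    rw [push_map_dsum, pull_map_dsum, push_id, pull_id, add_def]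
  have h1 : biprod.map (codiag X) (𝟙 X) ≫ codiag X =
      (biprod.associator X X X).hom ≫ biprod.map (𝟙 X) (codiag X) ≫ codiag X := by
    rw [biprod.associator_hom, map_comp_desc, map_comp_desc, biprod.lift_desc]
    ext <;> simp [biprod.lift_desc]
  have h2 : diag Z ≫ biprod.map (diag Z) (𝟙 Z) ≫ (biprod.associator Z Z Z).hom =
      diag Z ≫ biprod.map (𝟙 Z) (diag Z) := by
    ext <;> simp
  rw [add_def (x + y), e1, add_def x, e2, push_pull, push_pull, ← push_comp, ← push_comp,
    ← pull_comp, ← pull_comp, h1, push_comp, push_assoc, push_pull, ← pull_comp, Category.assoc, h2]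

/-- `Ext¹(Z, X)` is an abelian group under the Baer sum. -/
noncomputable instance (Z X : C) : AddCommGroup (Ext1 Z X) where
  add_assoc := add_assoc'
  zero_add x := by
    have := add_push 0 (𝟙 X) x
    rwa [push_zero, push_id, zero_add, push_id, eq_comm] at this
  add_zero x := by
    have := add_push (𝟙 X) 0 x
    rwa [push_zero, push_id, add_zero, push_id, eq_comm] at this
  nsmul := nsmulRec
  zsmul := zsmulRec
  neg_add_cancel x := by
    have := add_push (-𝟙 X) (𝟙 X) x
    rw [push_id, neg_add_cancel, push_zero] at this
    exact this.symm
  add_comm := add_comm'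

end Ext1

/-- The covariant functor `Ext¹(Z, -)`. -/
noncomputable def ext1Covariant (Z : C) : C ⥤ Ab.{max u v} where
  obj X := AddCommGrpCat.of (Ext1 Z X)
  map a := AddCommGrpCat.ofHom (AddMonoidHom.mk' (Ext1.push a) (Ext1.push_add a))
  map_id X := by ext x; exact Ext1.push_id x
  map_comp a a' := by ext x; exact Ext1.push_comp a a' x

/-- The contravariant functor `Ext¹(-, X)`. -/
noncomputable def ext1Contravariant (X : C) : Cᵒᵖ ⥤ Ab.{max u v} where
  obj Z := AddCommGrpCat.of (Ext1 Z.unop X)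
  map b := AddCommGrpCat.ofHom (AddMonoidHom.mk' (Ext1.pull b.unop) (Ext1.pull_add b.unop))
  map_id Z := by ext x; exact Ext1.pull_id x
  map_comp b b' := by ext x; exact Ext1.pull_comp b'.unop b.unop x

instance (Z : C) : (ext1Covariant Z).Additive where
  map_add {_ _ a b} := by ext x; exact Ext1.add_push a b x

instance (X : C) : (ext1Contravariant X).Additive where
  map_add {_ _ a b} := by ext x; exact Ext1.add_pull a.unop b.unop x

end Ext
end SemiAb

/-! Suppose `f` is irreducible. A proper epimorphism out of `Z` in the opposite category is a
monomorphism `b : Z' ⟶ Z` that is not an isomorphism, so minimality says that `ξ b` splits for each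
such `b`. Pulling back produces `v` from the middle term of `ξ b` to `Y`, and `f` factors as the
kernel of `ξ b` followed by `v`. Irreducibility leaves two cases. If the first factor is a section,
then `ξ b` splits. If `v` is a retraction, it is also monic, being a pullback of `b`, hence
invertible; then `g` factors through the monomorphism `b`, and a cokernel cannot factor through a
proper monomorphism (`IsCoker.isIso_of_fac`). This is `Ext1.pull_mk_eq_zero`. The class `ξ` is
nonzero because a split sequence would make `f` a section. Part (ii) is dual: push out along an
epimorphism and use `IsKer.isIso_of_fac` (`Ext1.push_mk_eq_zero`). Stability of `ξ` guarantees that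
`ξ b` and `a ξ` are again classes in `Ext¹`.

Indecomposability is formal and holds for any additive functor `F` with a minimal element `x`.
Decomposing the identity of the object as a sum of two idempotents `p ≫ i` and `q ≫ j` writes `x` as
the sum of its two components. The projections `p` and `q` are split epimorphisms; if neither were
invertible, both would kill `x`. So one projection is invertible and the complementary summand
vanishes. Because `IsMinimal.isIso_or_isIso` speaks of the four maps only, and not of a biproduct,
it applies in `Cᵒᵖ` as it stands. -/

namespace SemiAb

/-! ### Minimal elements of additive functors force indecomposability. -/

section Minimal

variable {C : Type u} [Category.{v} C] [Preadditive C]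

/-- A minimal element detects one of the two projections of a binary decomposition as an
isomorphism. -/
theorem IsMinimal.isIso_or_isIso {F : C ⥤ Ab.{w}} [F.Additive] {X A B : C} {x : F.obj X}
    (hx : IsMinimal F x) (p : X ⟶ A) (i : A ⟶ X) (q : X ⟶ B) (j : B ⟶ X) (hp : i ≫ p = 𝟙 A)
    (hq : j ≫ q = 𝟙 B) (h : p ≫ i + q ≫ j = 𝟙 X) : IsIso p ∨ IsIso q := by
  by_contra hn
  rw [not_or] at hn
  -- The sections `i` and `j` make `p` and `q` epimorphisms, so once they fail to be invertible
  -- minimality applies to both.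
  have e1 := hx.map_eq_zero p (epi_of_epi_fac hp) hn.1
  have e2 := hx.map_eq_zero q (epi_of_epi_fac hq) hn.2
  apply hx.ne_zero
  have h1 : F.map (p ≫ i + q ≫ j) x = x := by rw [h, F.map_id]; rfl
  have h2 : F.map (p ≫ i + q ≫ j) x = F.map i (F.map p x) + F.map j (F.map q x) := by
    rw [F.map_add, F.map_comp, F.map_comp]; rfl
  rw [← h1, h2, e1, e2, map_zero, map_zero, add_zero]

/-- On a zero object the identity is the zero map, which an additive functor sends to zero; every
element of `F.obj X` would then vanish. -/
theorem IsMinimal.not_isZero {F : C ⥤ Ab.{w}} [F.Additive] {X : C} {x : F.obj X}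
    (hx : IsMinimal F x) : ¬ IsZero X := fun h => by
  apply hx.ne_zero
  have h1 : F.map (0 : X ⟶ X) x = x := by rw [h.eq_of_src 0 (𝟙 X), F.map_id]; rfl
  rw [← h1, F.map_zero]
  rfl

/-- If the projection `p` is invertible, then `j ≫ p = 0` forces `j = 0`, and the identity `j ≫ q`
of `B` is zero. The disjunction serves both variances: the covariant argument finds `p` invertible,
while the contravariant one, where inclusions become projections, finds `i` invertible. -/
theorem isZero_of_isIso_left {X A B : C} (p : X ⟶ A) (q : X ⟶ B) (i : A ⟶ X) (j : B ⟶ X)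
    (hjp : j ≫ p = 0) (hp : i ≫ p = 𝟙 A) (hq : j ≫ q = 𝟙 B) (h : IsIso p ∨ IsIso i) :
    IsZero B := by
  have hp' : IsIso p := by
    rcases h with h | h
    · exact h
    · rw [IsIso.eq_inv_of_hom_inv_id hp]
      infer_instance
  have hj : j = 0 := by rw [← cancel_mono p, hjp, zero_comp]
  exact (IsZero.iff_id_eq_zero B).2 (by rw [← hq, hj, zero_comp])

variable [HasBinaryBiproducts C]

theorem isZero_right_of_iso {X A B : C} (e : X ≅ A ⊞ B)
    (h : IsIso (e.hom ≫ biprod.fst) ∨ IsIso (biprod.inl ≫ e.inv)) : IsZero B :=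
  isZero_of_isIso_left (e.hom ≫ biprod.fst) (e.hom ≫ biprod.snd) (biprod.inl ≫ e.inv)
    (biprod.inr ≫ e.inv) (by simp) (by simp) (by simp) h

theorem isZero_left_of_iso {X A B : C} (e : X ≅ A ⊞ B)
    (h : IsIso (e.hom ≫ biprod.snd) ∨ IsIso (biprod.inr ≫ e.inv)) : IsZero A :=
  isZero_of_isIso_left (e.hom ≫ biprod.snd) (e.hom ≫ biprod.fst) (biprod.inr ≫ e.inv)
    (biprod.inl ≫ e.inv) (by simp) (by simp) (by simp) h

/-- The decomposition of the identity of `A ⊞ B`, conjugated by `e`; it is what feeds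
`IsMinimal.isIso_or_isIso`. -/
theorem fst_inl_add_snd_inr_of_iso {X A B : C} (e : X ≅ A ⊞ B) :
    (e.hom ≫ biprod.fst) ≫ biprod.inl ≫ e.inv + (e.hom ≫ biprod.snd) ≫ biprod.inr ≫ e.inv =
      𝟙 X := by
  calc _ = e.hom ≫ (biprod.fst ≫ biprod.inl + biprod.snd ≫ biprod.inr) ≫ e.inv := by
        simp only [Preadditive.add_comp, Preadditive.comp_add, Category.assoc]
    _ = 𝟙 X := by rw [biprod.total, Category.id_comp, e.hom_inv_id]

/-- An object on which a covariant additive functor has a minimal element is indecomposable. -/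
theorem IsMinimal.indecomposable {F : C ⥤ Ab.{w}} [F.Additive] {X : C} {x : F.obj X}
    (hx : IsMinimal F x) : Indecomposable X := by
  refine ⟨hx.not_isZero, fun A B e => ?_⟩
  rcases hx.isIso_or_isIso (e.hom ≫ biprod.fst) (biprod.inl ≫ e.inv) (e.hom ≫ biprod.snd)
    (biprod.inr ≫ e.inv) (by simp) (by simp) (fst_inl_add_snd_inr_of_iso e) with h | h
  · exact .inr (isZero_right_of_iso e (.inl h))
  · exact .inl (isZero_left_of_iso e (.inl h))

/-- An object on which a contravariant additive functor has a minimal element is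
indecomposable. -/
theorem IsMinimal.indecomposable_unop {F : Cᵒᵖ ⥤ Ab.{w}} [F.Additive] {X : C}
    {x : F.obj (Opposite.op X)} (hx : IsMinimal F x) : Indecomposable X := by
  refine ⟨fun h => hx.not_isZero h.op, fun A B e => ?_⟩
  -- In `Cᵒᵖ` the opposites of the inclusions play the role of the projections, and those of the
  -- projections the role of their sections.
  rcases hx.isIso_or_isIso (biprod.inl ≫ e.inv).op (e.hom ≫ biprod.fst).op (biprod.inr ≫ e.inv).op
    (e.hom ≫ biprod.snd).op (by rw [← op_comp]; simp) (by rw [← op_comp]; simp)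
    (by rw [← op_comp, ← op_comp, ← op_add, ← op_id]
        exact congrArg _ (fst_inl_add_snd_inr_of_iso e)) with h | h
  · exact .inr (isZero_right_of_iso e (.inr ((isIso_op_iff _).1 h)))
  · exact .inl (isZero_left_of_iso e (.inr ((isIso_op_iff _).1 h)))

end Minimal

/-! ### Splitting of pullbacks and pushouts when one map of the sequence is irreducible. -/

section Stable

variable {C : Type u} [Category.{v} C] [Preadditive C]

/-- A monomorphism through which a cokernel factors is an isomorphism. -/
theorem IsCoker.isIso_of_fac {X Y Z W : C} {f : X ⟶ Y} {g : Y ⟶ Z} (h : IsCoker f g) {u : Y ⟶ W}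
    {b : W ⟶ Z} [Mono b] (hu : u ≫ b = g) : IsIso b := by
  obtain ⟨h1, h2, h3⟩ := isCoker_iff.1 h
  -- Since `b` is monic, `f ≫ g = 0` already gives `f ≫ u = 0`, so `u` descends along the cokernel
  -- `g`. The descended map `c` is a section of `b`.
  obtain ⟨c, hc⟩ := h3 u (by rw [← cancel_mono b, Category.assoc, hu, h1, zero_comp])
  have hcb : c ≫ b = 𝟙 Z := by
    rw [← cancel_epi g, ← Category.assoc, hc, hu, Category.comp_id]
  have : IsSplitEpi b := ⟨⟨⟨c, hcb⟩⟩⟩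
  exact isIso_of_mono_of_isSplitEpi b

/-- An epimorphism through which a kernel factors is an isomorphism. -/
theorem IsKer.isIso_of_fac {X Y Z W : C} {f : X ⟶ Y} {g : Y ⟶ Z} (h : IsKer f g) {a : X ⟶ W}
    {u : W ⟶ Y} [Epi a] (hu : a ≫ u = f) : IsIso a := by
  obtain ⟨h1, h2, h3⟩ := isKer_iff.1 h
  -- Dually, `u ≫ g = 0` because `a` is epic, so `u` lifts through the kernel `f`; the lift `c` is a
  -- retraction of `a`.
  obtain ⟨c, hc⟩ := h3 u (by rw [← cancel_epi a, ← Category.assoc, hu, h1, comp_zero])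
  have hac : a ≫ c = 𝟙 X := by
    rw [← cancel_mono f, Category.assoc, hc, hu, Category.id_comp]
  have : IsSplitMono a := ⟨⟨⟨c, hac⟩⟩⟩
  exact isIso_of_epi_of_isSplitMono a

variable [Preabelian C]

namespace Ext1

/-- A retraction of `ξ.f` together with `ξ.g` maps the middle term to `X ⊞ Z`, compatibly with the
identities on both ends. By `mk_eq` such a map of stable sequences identifies the classes; its
invertibility need not be shown separately. -/
theorem mk_eq_zero_of_isSplitMono {X Z : C} {ξ : Cplx X Z} (hξ : ξ.IsStable)
    (h : IsSplitMono ξ.f) : mk ξ hξ = 0 := by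
  have h1 : ξ.f ≫ biprod.lift (retraction ξ.f) ξ.g = 𝟙 X ≫ biprod.inl := by
    ext <;> simp [ξ.w]
  have h2 : biprod.lift (retraction ξ.f) ξ.g ≫ biprod.snd = ξ.g ≫ 𝟙 Z := by simp
  exact mk_eq ⟨_, h1, h2⟩

/-- A section of `ξ.g` naturally yields a map in the other direction, from the split sequence to
`ξ`. -/
theorem mk_eq_zero_of_isSplitEpi {X Z : C} {ξ : Cplx X Z} (hξ : ξ.IsStable)
    (h : IsSplitEpi ξ.g) : mk ξ hξ = 0 := by
  have h1 : biprod.inl ≫ biprod.desc ξ.f (section_ ξ.g) = 𝟙 X ≫ ξ.f := by simp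
  have h2 : biprod.desc ξ.f (section_ ξ.g) ≫ ξ.g = biprod.snd ≫ 𝟙 Z := by
    ext <;> simp [ξ.w]
  exact (mk_eq (hξ := Cplx.split_isStable X Z) ⟨_, h1, h2⟩).symm

theorem equivalent_split_of_mk_eq_zero {X Z : C} {ξ : Cplx X Z} {hξ : ξ.IsStable}
    (h : mk ξ hξ = 0) : Cplx.Equivalent ξ (Cplx.split X Z) :=
  Quotient.exact (s := stableSetoid Z X) h

theorem isSplitMono_of_mk_eq_zero {X Z : C} {ξ : Cplx X Z} {hξ : ξ.IsStable}
    (h : mk ξ hξ = 0) : IsSplitMono ξ.f := by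
  obtain ⟨e, h1, -⟩ := equivalent_split_of_mk_eq_zero h
  obtain ⟨r, hr⟩ : ∃ r, (Cplx.split X Z).f ≫ r = 𝟙 X := ⟨biprod.fst, biprod.inl_fst⟩
  exact ⟨⟨⟨e.hom ≫ r, by rw [← hr, ← h1, Category.assoc]⟩⟩⟩

theorem isSplitEpi_of_mk_eq_zero {X Z : C} {ξ : Cplx X Z} {hξ : ξ.IsStable}
    (h : mk ξ hξ = 0) : IsSplitEpi ξ.g := by
  obtain ⟨e, -, h2⟩ := equivalent_split_of_mk_eq_zero h
  obtain ⟨s, hs⟩ : ∃ s, s ≫ (Cplx.split X Z).g = 𝟙 Z := ⟨biprod.inr, biprod.inr_snd⟩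
  exact ⟨⟨⟨s ≫ e.inv, by rw [← h2, Category.assoc, e.inv_hom_id_assoc, hs]⟩⟩⟩

/-- The core of (i): `ξ.f` factors through the middle term of `ξ.pull b`, and irreducibility is
applied to this factorisation. -/
theorem pull_mk_eq_zero {X Z Z' : C} {ξ : Cplx X Z} (hξ : ξ.IsStable) (hf : IsIrreducible ξ.f)
    (b : Z' ⟶ Z) [Mono b] (hb : ¬ IsIso b) : pull b (mk ξ hξ) = 0 := by
  obtain ⟨v, hp, hv⟩ := ξ.pull_spec b
  rcases hf.factor _ v hv.symm with h | h
  -- Case `v` a retraction. As a pullback of the monomorphism `b` it is monic too, hence invertible.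
  · have hm : Mono v := ⟨fun s t hst => hp.hom_ext hst (by
      rw [← cancel_mono b, Category.assoc, Category.assoc, ← hp.w, reassoc_of% hst])⟩
    have : IsIso v := isIso_of_mono_of_isSplitEpi v
    -- Inverting `v` in the pullback square exhibits the cokernel `ξ.g` as a map followed by `b`,
    -- which would make `b` an isomorphism.
    exact absurd (hξ.shortExact.2.isIso_of_fac (u := inv v ≫ (ξ.pull b).g)
      (by rw [Category.assoc, ← hp.w, IsIso.inv_hom_id_assoc])) hb
  · exact mk_eq_zero_of_isSplitMono (hξ.pullStable b) h

/-- The core of (ii), dual to `pull_mk_eq_zero`: here `ξ.g` factors through the middle term of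
`ξ.push a`. -/
theorem push_mk_eq_zero {X X' Z : C} {ξ : Cplx X Z} (hξ : ξ.IsStable) (hg : IsIrreducible ξ.g)
    (a : X ⟶ X') [Epi a] (ha : ¬ IsIso a) : push a (mk ξ hξ) = 0 := by
  obtain ⟨v, hp, hv⟩ := ξ.push_spec a
  rcases hg.factor v _ hv.symm with h | h
  · exact mk_eq_zero_of_isSplitEpi (hξ.pushStable a) h
  -- Case `v` a section. A pushout of the epimorphism `a` is epic, so `v` is invertible, and then
  -- the kernel `ξ.f` factors as `a` followed by a map to `ξ.Y`.
  · have hm : Epi v := ⟨fun s t hst => hp.hom_ext (by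
      rw [← cancel_epi a, ← Category.assoc, ← Category.assoc, hp.w, Category.assoc, hst,
        Category.assoc]) hst⟩
    have : IsIso v := isIso_of_epi_of_isSplitMono v
    exact absurd (hξ.shortExact.1.isIso_of_fac (u := (ξ.push a).f ≫ inv v)
      (by rw [← Category.assoc, hp.w, Category.assoc, IsIso.hom_inv_id, Category.comp_id])) ha

end Ext1

theorem isMinimal_contravariant {X Z : C} {ξ : Cplx X Z} (hξ : ξ.IsStable)
    (hf : IsIrreducible ξ.f) :
    IsMinimal (ext1Contravariant X) (X := Opposite.op Z) (Ext1.mk ξ hξ) where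
  ne_zero h := hf.not_section (Ext1.isSplitMono_of_mk_eq_zero h)
  map_eq_zero b _ hb :=
    -- The epimorphism `b` lives in `Cᵒᵖ`; in `C` it is a monomorphism into `Z`.
    have : Mono b.unop := inferInstance
    Ext1.pull_mk_eq_zero hξ hf b.unop fun h => hb ((isIso_unop_iff b).1 h)

theorem isMinimal_covariant {X Z : C} {ξ : Cplx X Z} (hξ : ξ.IsStable)
    (hg : IsIrreducible ξ.g) : IsMinimal (ext1Covariant Z) (X := X) (Ext1.mk ξ hξ) where
  ne_zero h := hg.not_retraction (Ext1.isSplitEpi_of_mk_eq_zero h)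
  map_eq_zero a _ ha := Ext1.push_mk_eq_zero hξ hg a ha

end Stable
end SemiAb

theorem mainTheorem5 {C : Type u} [Category.{v} C] [Preadditive C] [SemiAb.SemiAbelian C]
    {X Z : C} (ξ : SemiAb.Cplx X Z) (hξ : ξ.IsStable) :
    (SemiAb.IsIrreducible ξ.f →
      SemiAb.IsMinimal (SemiAb.ext1Contravariant X) (X := Opposite.op Z) (SemiAb.Ext1.mk ξ hξ) ∧
        Indecomposable Z) ∧
    (SemiAb.IsIrreducible ξ.g →
      SemiAb.IsMinimal (SemiAb.ext1Covariant Z) (X := X) (SemiAb.Ext1.mk ξ hξ) ∧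
        Indecomposable X) :=
  ⟨fun hf => ⟨SemiAb.isMinimal_contravariant hξ hf,
    (SemiAb.isMinimal_contravariant hξ hf).indecomposable_unop⟩,
   fun hg => ⟨SemiAb.isMinimal_covariant hξ hg,
    (SemiAb.isMinimal_covariant hξ hg).indecomposable⟩⟩
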